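/- For $n\ge 0$ let $\mathcal{PT}_n$ be the monoid of all partial maps from $[n]=\{1,\dots,n\}$ to itself under composition (from left to right), and for $0\le m\le n$ let $I_m=\{\alpha\in\mathcal{PT}_n : |\operatorname{im}\alpha|\le m\}$ be the ideal of all partial maps of rank at most $m$, regarded as a semigroup. Let $S$ be a finite semigroup whose $\mathcal J$-classes form a chain $J_\epsilon<J_{\epsilon+1}<\dots<J_k$ (where $J_x\le J_y$ means $S^1xS^1\subseteq S^1yS^1$). An element $s\in J_i$ has depth $k-i+1$, that is, its depth is the number of $\mathcal J$-classes lying above or equal to its own. A presentation of $S$ is a pair $\langle A\mid R\rangle$ with $A$ a finite alphabet and $R\subseteq A^+\times A^+$, such that $A^+/R^\sharp\cong S$, where $A^+$ is the free semigroup on $A$ and $R^\sharp$ is the smallest congruence on $A^+$ containing $R$. The depth of a defining relation $(u=v)\in R$ is the depth of the element of $S$ represented by $u$ (equivalently, by $v$); the depth of the presentation is the maximal depth of its defining relations; and the relational depth $\operatorname{dep}(S)$ is the minimum of the depths of all presentations of $S$. Theorem. Let $0\le m\le n$, and if $m=n$ assume also that $n\ge 2$. Then $$\operatorname{dep}(I_m)=\begin{cases}3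 & \text{if } m=n,\\ n-m+1 & \text{if } n>m>\tfrac n2,\\ m+1 & \text{if } m<n \text{ and } m\le \tfrac n2.\end{cases}$$ -/

import Mathlib

/-! ### Green's `J`-relation and depth in a semigroup -/

/-- The principal two-sided ideal `S¹ x S¹` of a semigroup `S`, where `S¹` is `S` with an identity
adjoined. -/
def principalIdeal {S : Type*} [Semigroup S] (x : S) : Set S :=
  {z | ∃ a b : WithOne S, (z : WithOne S) = a * (x : WithOne S) * b}

/-- The `J`-class of `x`: all `y` with `S¹ y S¹ = S¹ x S¹`. -/
def jClass {S : Type*} [Semigroup S] (x : S) : Set S :=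
  {y | principalIdeal y = principalIdeal x}

/-- The depth of an element `s`: the number of `J`-classes that lie above or equal to the `J`-class
of `s`, where `J_x ≤ J_y` means `S¹ x S¹ ⊆ S¹ y S¹`.  If the `J`-classes of `S` form a finite chain
`J_ε < ⋯ < J_k` and `s ∈ J_i`, this number is `k - i + 1`. -/
noncomputable def elementDepth {S : Type*} [Semigroup S] (s : S) : ℕ∞ :=
  Set.encard {J : Set S | ∃ t : S, J = jClass t ∧ principalIdeal s ⊆ principalIdeal t}

/-! ### Semigroup presentations and relational depth -/

/-- A presentation `⟨A | R⟩` of the semigroup `S`: a finite alphabet `A`, a set `R ⊆ A⁺ × A⁺` of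
defining relations, and an identification of `A⁺ / R♯` with `S`, where `A⁺` is the free semigroup
on `A` and `R♯` is the smallest congruence on `A⁺` containing `R`. -/
structure SemigroupPresentation (S : Type*) [Semigroup S] where
  /-- the alphabet -/
  alphabet : Type
  finite_alphabet : Finite alphabet
  /-- the defining relations -/
  relations : Set (FreeSemigroup alphabet × FreeSemigroup alphabet)
  /-- the isomorphism of the presented semigroup with `S` -/
  iso : (conGen fun u v => (u, v) ∈ relations).Quotient ≃* S

namespace SemigroupPresentation

variable {S : Type*} [Semigroup S]

/-- The element of `S` represented by a word. -/
def eval (P : SemigroupPresentation S) (w : FreeSemigroup P.alphabet) : S :=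
  P.iso (w : (conGen fun u v => (u, v) ∈ P.relations).Quotient)

/-- The depth of a presentation: the maximal depth of a defining relation `u = v`, which is the
depth of the element represented by `u` (equivalently, by `v`). -/
noncomputable def depth (P : SemigroupPresentation S) : ℕ∞ :=
  ⨆ p ∈ P.relations, elementDepth (P.eval p.1)

end SemigroupPresentation

/-- The relational depth of `S`: the minimum of the depths of all presentations of `S`.  (An infimum
of a non-empty family in `ℕ∞` is attained.) -/
noncomputable def relationalDepth (S : Type*) [Semigroup S] : ℕ∞ :=
  ⨅ P : SemigroupPresentation S, P.depth

/-! ### The partial transformation monoid and its ideals -/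

/-- Partial maps from `{1, …, n}` to itself; `f x = none` means that `x` is outside the domain. -/
def PartialTransformation (n : ℕ) : Type := Fin n → Option (Fin n)

namespace PartialTransformation

variable {n : ℕ}

/-- Multiplication is composition of partial maps, written from left to right: `x (f g) = (x f) g`. -/
instance : Monoid (PartialTransformation n) where
  mul f g := fun x => Option.bind (f x) g
  one := fun x => some x
  mul_assoc f g h := funext fun x => Option.bind_assoc (f x) g h
  one_mul _ := rfl
  mul_one f := funext fun x => Option.bind_fun_some (f x)

theorem mul_apply_eq_some_iff (f g : PartialTransformation n) (x y : Fin n) :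
    (f * g) x = some y ↔ ∃ z, f x = some z ∧ g z = some y :=
  Option.bind_eq_some_iff (x := f x) (f := g)

/-- The image of a partial transformation. -/
def image (f : PartialTransformation n) : Set (Fin n) := {y | ∃ x, f x = some y}

/-- The rank of a partial transformation: the size of its image. -/
noncomputable def rank (f : PartialTransformation n) : ℕ := f.image.ncard

theorem rank_mul_le_left (f g : PartialTransformation n) : (f * g).rank ≤ f.rank := by
  have h : (fun y => some y) '' (f * g).image ⊆ g '' f.image := by
    rintro _ ⟨y, ⟨x, hx⟩, rfl⟩
    obtain ⟨z, hz, hy⟩ := (mul_apply_eq_some_iff f g x y).1 hx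
    exact ⟨z, ⟨x, hz⟩, hy⟩
  calc (f * g).rank = ((fun y => some y) '' (f * g).image).ncard :=
        (Set.ncard_image_of_injective _ (Option.some_injective _)).symm
    _ ≤ (g '' f.image).ncard := Set.ncard_le_ncard h (Set.toFinite _)
    _ ≤ f.rank := Set.ncard_image_le (Set.toFinite _)

theorem rank_mul_le_right (f g : PartialTransformation n) : (f * g).rank ≤ g.rank := by
  refine Set.ncard_le_ncard ?_ (Set.toFinite _)
  rintro y ⟨x, hx⟩
  obtain ⟨z, -, hy⟩ := (mul_apply_eq_some_iff f g x y).1 hx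
  exact ⟨z, hy⟩

/-- The ideal `I_m` of all partial transformations of rank at most `m`, as a subsemigroup. -/
def rankIdeal (n m : ℕ) : Subsemigroup (PartialTransformation n) where
  carrier := {f | f.rank ≤ m}
  mul_mem' {f g} hf _ := (rank_mul_le_left f g).trans hf

/-- `rankIdeal n m` is a two-sided ideal. -/
theorem mul_mem_rankIdeal {n m : ℕ} {f : PartialTransformation n} (hf : f ∈ rankIdeal n m)
    (g : PartialTransformation n) : f * g ∈ rankIdeal n m ∧ g * f ∈ rankIdeal n m :=
  ⟨(rank_mul_le_left f g).trans hf, (rank_mul_le_right g f).trans hf⟩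

end PartialTransformation

/-! In `rankIdeal n m` the `J`-classes are the ranks, so rank `j` has depth `m - j + 1`, and the
question is how low in rank the defining relations must reach.

Upper bound (`relationalDepth_rankIdeal_le`): present the ideal by its elements of rank at least `r`
and all true relations of rank at least `r`. The relations of each lower rank `k` follow from those
above it. Every word of rank `k` becomes a product of two elements of rank above `k`, and any two
such factorizations of the same map are linked by moving a middle factor across the junction,
through products of rank above `k` (`map_mul_map_eq`). The links exist when `k + 2 ≤ m`, `k + 3 ≤ n`
and `k + n < 2 * m`; the last condition prevents both factors from having rank `m`.

Lower bound (`le_relationalDepth_rankIdeal_of_sets`): let `μ` be the largest rank in the ideal below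
`n`, and let two distinct `μ`-sets meet in at most `r` points. Their partial identities commute. An
automaton that records the domain to the left of the junction where the rank drops to at most `r`
respects every relation of rank above `r` (`next_mul`), but tells the two orders apart. The smallest
possible intersection has `2 * μ - n` points, or none. -/

namespace PartialTransformation

variable {n : ℕ}

/-! ### Images, ranks, restrictions and point changes -/

theorem mul_apply (f g : PartialTransformation n) (x : Fin n) :
    (f * g) x = (f x).bind g := rfl

theorem mul_apply_of_some {f : PartialTransformation n} {x y : Fin n} (h : f x = some y)
    (g : PartialTransformation n) : (f * g) x = g y := by
  rw [mul_apply, h]; rfl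

theorem mul_apply_of_none {f : PartialTransformation n} {x : Fin n} (h : f x = none)
    (g : PartialTransformation n) : (f * g) x = none := by
  rw [mul_apply, h]; rfl

/-- The set of values of `f` on `Y`. -/
def mapSet (Y : Set (Fin n)) (f : PartialTransformation n) : Set (Fin n) :=
  {v | ∃ u ∈ Y, f u = some v}

/-- The domain of a partial transformation. -/
def dom (f : PartialTransformation n) : Set (Fin n) := {x | f x ≠ none}

theorem mapSet_univ (f : PartialTransformation n) : mapSet Set.univ f = f.image := by
  ext v; simp [mapSet, image]

theorem image_mul (f g : PartialTransformation n) : (f * g).image = mapSet f.image g := by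
  ext v
  constructor
  · rintro ⟨x, hx⟩
    obtain ⟨z, hz, hv⟩ := (mul_apply_eq_some_iff f g x v).1 hx
    exact ⟨z, ⟨x, hz⟩, hv⟩
  · rintro ⟨z, ⟨x, hz⟩, hv⟩
    exact ⟨x, (mul_apply_eq_some_iff f g x v).2 ⟨z, hz, hv⟩⟩

theorem mapSet_mul (Y : Set (Fin n)) (f g : PartialTransformation n) :
    mapSet Y (f * g) = mapSet (mapSet Y f) g := by
  ext v
  constructor
  · rintro ⟨x, hY, hx⟩
    obtain ⟨z, hz, hv⟩ := (mul_apply_eq_some_iff f g x v).1 hx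
    exact ⟨z, ⟨x, hY, hz⟩, hv⟩
  · rintro ⟨z, ⟨x, hY, hz⟩, hv⟩
    exact ⟨x, hY, (mul_apply_eq_some_iff f g x v).2 ⟨z, hz, hv⟩⟩

theorem mapSet_mono {Y Z : Set (Fin n)} (h : Y ⊆ Z) (f : PartialTransformation n) :
    mapSet Y f ⊆ mapSet Z f := fun _ ⟨u, hu, hv⟩ => ⟨u, h hu, hv⟩

theorem mapSet_union (Y Z : Set (Fin n)) (f : PartialTransformation n) :
    mapSet (Y ∪ Z) f = mapSet Y f ∪ mapSet Z f := by
  ext v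
  constructor
  · rintro ⟨u, hu | hu, hv⟩
    exacts [Or.inl ⟨u, hu, hv⟩, Or.inr ⟨u, hu, hv⟩]
  · rintro (⟨u, hu, hv⟩ | ⟨u, hu, hv⟩)
    exacts [⟨u, Or.inl hu, hv⟩, ⟨u, Or.inr hu, hv⟩]

theorem ncard_mapSet_le (Y : Set (Fin n)) (f : PartialTransformation n) :
    (mapSet Y f).ncard ≤ Y.ncard := by
  have h : (fun y => some y) '' mapSet Y f ⊆ f '' Y := by
    rintro _ ⟨y, ⟨x, hx, hy⟩, rfl⟩
    exact ⟨x, hx, hy⟩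
  calc (mapSet Y f).ncard = ((fun y => some y) '' mapSet Y f).ncard :=
        (Set.ncard_image_of_injective _ (Option.some_injective _)).symm
    _ ≤ (f '' Y).ncard := Set.ncard_le_ncard h (Set.toFinite _)
    _ ≤ Y.ncard := Set.ncard_image_le (Set.toFinite _)

/-- A partial map that is defined and injective on `X` is so on every subset of `X`. -/
theorem ncard_mapSet_eq_of_subset {X Y : Set (Fin n)} (h : Y ⊆ X) {f : PartialTransformation n}
    (hf : (mapSet X f).ncard = X.ncard) : (mapSet Y f).ncard = Y.ncard := by
  have h1 : mapSet X f = mapSet Y f ∪ mapSet (X \ Y) f := by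
    rw [← mapSet_union, Set.union_sdiff_cancel h]
  have h2 := Set.ncard_union_le (mapSet Y f) (mapSet (X \ Y) f)
  have h3 := ncard_mapSet_le (X \ Y) f
  have h4 := ncard_mapSet_le Y f
  have h5 := Set.ncard_sdiff_add_ncard_of_subset h (Set.toFinite _)
  rw [← h1] at h2
  omega

theorem rank_le_ncard {f : PartialTransformation n} {X : Set (Fin n)} (h : f.image ⊆ X) :
    f.rank ≤ X.ncard := Set.ncard_le_ncard h (Set.toFinite _)

theorem ncard_le_rank {f : PartialTransformation n} {X : Set (Fin n)} (h : X ⊆ f.image) :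
    X.ncard ≤ f.rank := Set.ncard_le_ncard h (Set.toFinite _)

theorem rank_le (f : PartialTransformation n) : f.rank ≤ n := by
  have := rank_le_ncard (Set.subset_univ f.image)
  rwa [Set.ncard_univ, Nat.card_eq_fintype_card, Fintype.card_fin] at this

theorem image_eq_univ {f : PartialTransformation n} (h : f.rank = n) : f.image = Set.univ := by
  refine Set.eq_of_subset_of_ncard_le (Set.subset_univ _) ?_ (Set.toFinite _)
  rw [Set.ncard_univ, Nat.card_eq_fintype_card, Fintype.card_fin]
  exact h.ge

theorem image_mul_subset (f g : PartialTransformation n) : (f * g).image ⊆ g.image := by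
  rw [image_mul, ← mapSet_univ g]
  exact mapSet_mono (Set.subset_univ _) _

theorem image_mul_eq {f g : PartialTransformation n} (h : g.rank ≤ (f * g).rank) :
    (f * g).image = g.image :=
  Set.eq_of_subset_of_ncard_le (image_mul_subset f g) h (Set.toFinite _)

theorem ncard_compl_image (f : PartialTransformation n) : f.imageᶜ.ncard = n - f.rank := by
  rw [Set.ncard_compl, Nat.card_eq_fintype_card, Fintype.card_fin, rank]

/-- The values of `g` not attained by `f * g` come from the `n - f.rank` points that `f` misses. -/
theorem rank_add_rank_le (f g : PartialTransformation n) : f.rank + g.rank ≤ (f * g).rank + n := by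
  have h1 : g.image = (f * g).image ∪ mapSet f.imageᶜ g := by
    rw [image_mul, ← mapSet_union, Set.union_compl_self, mapSet_univ]
  have h2 := Set.ncard_union_le (f * g).image (mapSet f.imageᶜ g)
  have h3 := ncard_mapSet_le f.imageᶜ g
  rw [ncard_compl_image] at h3
  rw [← h1] at h2
  have := f.rank_le
  simp only [rank] at *
  omega

theorem exists_notMem_image {f : PartialTransformation n} (h : f.rank < n) : ∃ z, z ∉ f.image := by
  by_contra! H
  have : (Set.univ : Set (Fin n)) ⊆ f.image := fun z _ => H z
  have := ncard_le_rank this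
  rw [Set.ncard_univ, Nat.card_eq_fintype_card, Fintype.card_fin] at this
  omega

theorem exists_ne_notMem_image {f : PartialTransformation n} (h : f.rank + 2 ≤ n) :
    ∃ z w, z ∉ f.image ∧ w ∉ f.image ∧ z ≠ w := by
  have h1 : 1 < f.imageᶜ.ncard := by rw [ncard_compl_image]; omega
  obtain ⟨z, w, hz, hw, hzw⟩ := (Set.one_lt_ncard (Set.toFinite _)).1 h1
  exact ⟨z, hz, w, hw, hzw⟩

theorem mul_congr_right {p f g : PartialTransformation n} (h : ∀ v ∈ p.image, f v = g v) :
    p * f = p * g := by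
  funext x
  cases hx : p x with
  | none => rw [mul_apply_of_none hx, mul_apply_of_none hx]
  | some v => rw [mul_apply_of_some hx, mul_apply_of_some hx, h v ⟨x, hx⟩]

theorem mul_eq_self {p f : PartialTransformation n} (h : ∀ v ∈ p.image, f v = some v) :
    p * f = p := by
  rw [mul_congr_right (g := 1) h, mul_one]

/-- The restriction of a partial transformation to a set. -/
noncomputable def restrict (W : Set (Fin n)) (f : PartialTransformation n) :
    PartialTransformation n := by
  classical exact fun x => if x ∈ W then f x else none

theorem restrict_of_mem {W : Set (Fin n)} {x : Fin n} (h : x ∈ W) (f : PartialTransformation n) :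
    restrict W f x = f x := if_pos h

theorem restrict_of_notMem {W : Set (Fin n)} {x : Fin n} (h : x ∉ W)
    (f : PartialTransformation n) : restrict W f x = none := if_neg h

theorem image_restrict (W : Set (Fin n)) (f : PartialTransformation n) :
    (restrict W f).image = mapSet W f := by
  ext v
  constructor
  · rintro ⟨x, hx⟩
    by_cases h : x ∈ W
    · exact ⟨x, h, by rwa [restrict_of_mem h] at hx⟩
    · rw [restrict_of_notMem h] at hx; cases hx
  · rintro ⟨x, h, hx⟩
    exact ⟨x, by rwa [restrict_of_mem h]⟩

theorem mapSet_one (W : Set (Fin n)) : mapSet W 1 = W := by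
  ext v
  constructor
  · rintro ⟨u, hu, h⟩
    obtain rfl : u = v := Option.some_injective _ h
    exact hu
  · exact fun h => ⟨v, h, rfl⟩

theorem rank_restrict_le (W : Set (Fin n)) (f : PartialTransformation n) :
    (restrict W f).rank ≤ W.ncard := by
  rw [rank, image_restrict]; exact ncard_mapSet_le _ _

theorem rank_restrict_one (W : Set (Fin n)) : (restrict W 1).rank = W.ncard := by
  rw [rank, image_restrict, mapSet_one]

theorem exists_rank_eq {j : ℕ} (h : j ≤ n) : ∃ f : PartialTransformation n, f.rank = j := by
  obtain ⟨W, -, hW⟩ := Set.exists_subset_card_eq (s := (Set.univ : Set (Fin n))) (n := j)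
    (by rwa [Set.ncard_univ, Nat.card_eq_fintype_card, Fintype.card_fin])
  exact ⟨restrict W 1, by rw [rank_restrict_one, hW]⟩

/-- The partial transformation `f` with its value at `x` redefined to be `y`. -/
def setAt (f : PartialTransformation n) (x y : Fin n) : PartialTransformation n :=
  fun v => if v = x then some y else f v

theorem setAt_self (f : PartialTransformation n) (x y : Fin n) : f.setAt x y x = some y :=
  if_pos rfl

theorem setAt_of_ne (f : PartialTransformation n) {x v : Fin n} (h : v ≠ x) (y : Fin n) :
    f.setAt x y v = f v := if_neg h

theorem image_setAt_subset (f : PartialTransformation n) (x y : Fin n) :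
    (f.setAt x y).image ⊆ insert y f.image := by
  rintro v ⟨u, hu⟩
  by_cases h : u = x
  · subst h; rw [setAt_self] at hu; exact Or.inl (Option.some_injective _ hu).symm
  · rw [setAt_of_ne _ h] at hu; exact Or.inr ⟨u, hu⟩

theorem rank_setAt_le (f : PartialTransformation n) (x y : Fin n) :
    (f.setAt x y).rank ≤ f.rank + 1 :=
  (rank_le_ncard (image_setAt_subset f x y)).trans (Set.ncard_insert_le _ _)

theorem lt_rank_of_mem {f s : PartialTransformation n} {y : Fin n} (hs : s.image ⊆ f.image)
    (hf : y ∈ f.image) (hy : y ∉ s.image) : s.rank < f.rank :=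
  Set.ncard_lt_ncard (Set.ssubset_iff_of_subset hs |>.2 ⟨y, hf, hy⟩) (Set.toFinite _)

theorem exists_mem_notMem_of_rank_lt {f s : PartialTransformation n} (h : s.rank < f.rank) :
    ∃ y ∈ f.image, y ∉ s.image := by
  by_contra! H
  exact absurd (rank_le_ncard H) (not_le.2 h)

/-! ### Redundant points and factorizations into larger ranks -/

/-- If composing with `q` lowers the rank of `p`, then some point of the image of `p` can be left
out without changing the set of values of `q`. -/
theorem exists_redundant {p q : PartialTransformation n} (h : (p * q).rank < p.rank) :
    ∃ b ∈ p.image, ∀ y ∈ (p * q).image, ∃ v ∈ p.image, v ≠ b ∧ q v = some y := by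
  have hex : ∀ y ∈ (p * q).image, ∃ v ∈ p.image, q v = some y := by
    rw [image_mul]; exact fun y hy => hy
  choose! σ hσ hσq using hex
  have : ∃ b ∈ p.image, b ∉ σ '' (p * q).image := by
    by_contra! H
    have := (Set.ncard_le_ncard H (Set.toFinite _)).trans (Set.ncard_image_le (Set.toFinite _))
    exact absurd this (not_le.2 h)
  obtain ⟨b, hb, hbσ⟩ := this
  refine ⟨b, hb, fun y hy => ⟨σ y, hσ y hy, ?_, hσq y hy⟩⟩
  rintro rfl
  exact hbσ ⟨y, hy, rfl⟩

theorem image_setAt_of_redundant {s : PartialTransformation n} {x w : Fin n}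
    (hx : ∀ y ∈ s.image, ∃ v, v ≠ x ∧ s v = some y) : (s.setAt x w).image = insert w s.image := by
  refine (image_setAt_subset s x w).antisymm ?_
  rintro y (rfl | hy)
  · exact ⟨x, setAt_self _ _ _⟩
  · obtain ⟨v, hv, hs⟩ := hx y hy
    exact ⟨v, by rwa [setAt_of_ne _ hv]⟩

theorem rank_setAt_of_redundant {s : PartialTransformation n} {x w : Fin n}
    (hw : w ∉ s.image) (hx : ∀ y ∈ s.image, ∃ v, v ≠ x ∧ s v = some y) :
    (s.setAt x w).rank = s.rank + 1 := by
  rw [rank, image_setAt_of_redundant hx, Set.ncard_insert_of_notMem hw (Set.toFinite _), rank]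

/-- Moving a redundant point of `s` to a new value gives a left factor of `s`. -/
theorem exists_setAt_mul_eq {s : PartialTransformation n} {x w : Fin n}
    (hw : w ∉ s.image) (hx : ∀ y ∈ s.image, ∃ v, v ≠ x ∧ s v = some y) (hn : s.rank + 2 ≤ n) :
    ∃ q : PartialTransformation n, q.rank = s.rank + 1 ∧ s.setAt x w * q = s := by
  obtain ⟨z, hz⟩ := exists_notMem_image (f := s.setAt x w)
    (by rw [rank_setAt_of_redundant hw hx]; omega)
  rw [image_setAt_of_redundant hx, Set.mem_insert_iff, not_or] at hz
  -- `q` sends `w` back to the old value at `x` and fixes the image of `s`. The spare point `z` is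
  -- kept only to raise the rank of `q` above that of `s`.
  let q : PartialTransformation n := fun v => if v = w then s x else restrict (insert z s.image) 1 v
  have hqw : q w = s x := if_pos rfl
  have hq : ∀ v, v ≠ w → q v = restrict (insert z s.image) 1 v := fun v hv => if_neg hv
  have hqs : ∀ v ∈ insert z s.image, q v = some v := by
    intro v hv
    rw [hq, restrict_of_mem hv]
    · rfl
    · rintro rfl
      exact hv.elim (fun h => hz.1 h.symm) hw
  have him : q.image = insert z s.image := by
    ext y
    constructor
    · rintro ⟨v, hv⟩
      by_cases h : v = w
      · subst h; rw [hqw] at hv; exact Or.inr ⟨x, hv⟩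
      · rw [hq v h] at hv
        have : y ∈ (restrict (insert z s.image) 1).image := ⟨v, hv⟩
        rwa [image_restrict, mapSet_one] at this
    · exact fun hy => ⟨y, hqs y hy⟩
  refine ⟨q, by rw [rank, him, Set.ncard_insert_of_notMem hz.2 (Set.toFinite _), rank], ?_⟩
  funext u
  by_cases h : u = x
  · subst h; rw [mul_apply_of_some (setAt_self _ _ _), hqw]
  · have h1 := setAt_of_ne s h w
    cases hu : s u with
    | none => rw [mul_apply_of_none (h1.trans hu)]
    | some v => rw [mul_apply_of_some (h1.trans hu), hqs v (Or.inr ⟨u, hu⟩)]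

/-- A partial transformation `s` of small rank that has the same rank as `x * s` factorizes into two
partial transformations of larger rank, the left one having large rank after `x`. -/
theorem exists_factorization {x s : PartialTransformation n} (hxs : (x * s).rank = s.rank)
    (hx : s.rank < x.rank) (hn : s.rank + 2 ≤ n) :
    ∃ p q : PartialTransformation n, p.rank = s.rank + 1 ∧ q.rank = s.rank + 1 ∧ p * q = s ∧
      s.rank < (x * p).rank := by
  -- The redundant point is taken inside the image of `x`, so that the new value `w` is also
  -- attained after `x`.
  obtain ⟨b, hb, hbv⟩ := exists_redundant (p := x) (q := s) (by omega)
  rw [image_mul_eq hxs.ge] at hbv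
  obtain ⟨w, hw⟩ := exists_notMem_image (f := s) (by omega)
  have hred : ∀ y ∈ s.image, ∃ v, v ≠ b ∧ s v = some y := fun y hy => by
    obtain ⟨v, -, h⟩ := hbv y hy
    exact ⟨v, h⟩
  obtain ⟨q, hq, hpq⟩ := exists_setAt_mul_eq hw hred hn
  refine ⟨_, q, rank_setAt_of_redundant hw hred, hq, hpq, lt_rank_of_mem (y := w) ?_ ?_ hw⟩
  · intro y hy
    obtain ⟨v, hv, hvb, hs⟩ := hbv y hy
    rw [image_mul]
    exact ⟨v, hv, by rwa [setAt_of_ne _ hvb]⟩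
  · rw [image_mul]
    exact ⟨b, hb, setAt_self _ _ _⟩

/-! ### Linking the factorizations of a map of rank `k` -/

section Connectivity

variable {m k : ℕ} {T : Type*} [Semigroup T] {ν : PartialTransformation n → T}

/-- The elementary move: `ν` is multiplicative only on products of rank above `k`, which suffices to
carry the middle factor `t` across the junction although `p * t * q` itself may have rank `k`. -/
theorem map_mul_map_comm
    (hν : ∀ x y : PartialTransformation n, x.rank ≤ m → y.rank ≤ m → k < (x * y).rank →
      ν (x * y) = ν x * ν y)
    {p t q : PartialTransformation n} (hp : p.rank ≤ m) (ht : t.rank ≤ m) (hq : q.rank ≤ m)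
    (hpt : k < (p * t).rank) (htq : k < (t * q).rank) :
    ν (p * t) * ν q = ν p * ν (t * q) := by
  rw [hν p t hp ht hpt, hν t q ht hq htq, mul_assoc]

theorem rank_setAt_restrict_le (W : Set (Fin n)) (f : PartialTransformation n) (x y : Fin n) :
    ((restrict W f).setAt x y).rank ≤ W.ncard + 1 :=
  (rank_setAt_le _ _ _).trans (Nat.succ_le_succ (rank_restrict_le _ _))

theorem setAt_restrict_of_mem {W : Set (Fin n)} {f : PartialTransformation n} {x v : Fin n}
    (hv : v ∈ W) (hx : x ∉ W) (y : Fin n) : (restrict W f).setAt x y v = f v := by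
  rw [setAt_of_ne _ (ne_of_mem_of_not_mem hv hx), restrict_of_mem hv]

theorem setAt_restrict_of_notMem {W : Set (Fin n)} {f : PartialTransformation n} {x v : Fin n}
    (hv : v ∉ W) (hx : v ≠ x) (y : Fin n) : (restrict W f).setAt x y v = none := by
  rw [setAt_of_ne _ hx, restrict_of_notMem hv]

/-- In a factorization `p * q`, the right factor can be changed outside the image of `p`, as long as
one of the values outside the image of `p * q` is kept. -/
theorem map_mul_map_eq_of_eqOn
    (hν : ∀ x y : PartialTransformation n, x.rank ≤ m → y.rank ≤ m → k < (x * y).rank →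
      ν (x * y) = ν x * ν y)
    {p q q' : PartialTransformation n} (hp : p.rank + 1 ≤ m) (hq : q.rank ≤ m) (hq' : q'.rank ≤ m)
    (hpk : k < p.rank) (hk : (p * q).rank = k) (hqq : ∀ v ∈ p.image, q' v = q v)
    {z z' y : Fin n} (hz' : z' ∉ p.image) (hqz : q z = some y)
    (hqz' : q' z' = some y) (hy : y ∉ (p * q).image) : ν p * ν q = ν p * ν q' := by
  -- The middle factor is the identity on the image of `p` and sends `z'` to `c`; `p` absorbs it.
  -- With `c = z` before `q` and `c = z'` before `q'` the products agree, and attaining `y` keeps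
  -- their rank above `k`.
  have hpt : ∀ c, p * (restrict p.image 1).setAt z' c = p := fun c =>
    mul_eq_self fun v hv => setAt_restrict_of_mem hv hz' c
  have hr : ∀ c, ((restrict p.image 1).setAt z' c).rank ≤ m := fun c =>
    (rank_setAt_restrict_le _ _ _ _).trans hp
  have heq : (restrict p.image 1).setAt z' z * q = (restrict p.image 1).setAt z' z' * q' := by
    funext v
    by_cases h1 : v = z'
    · subst h1
      rw [mul_apply_of_some (setAt_self _ _ _), mul_apply_of_some (setAt_self _ _ _), hqz, hqz']
    · by_cases h2 : v ∈ p.image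
      · have h3 := fun c => setAt_restrict_of_mem (f := 1) h2 hz' c
        rw [mul_apply_of_some (h3 z), mul_apply_of_some (h3 z'), hqq v h2]
      · have h3 := fun c => setAt_restrict_of_notMem (f := 1) h2 h1 c
        rw [mul_apply_of_none (h3 z), mul_apply_of_none (h3 z')]
  have hlt : k < ((restrict p.image 1).setAt z' z * q).rank := by
    rw [← hk]
    refine lt_rank_of_mem (y := y) ?_ ?_ hy
    · nth_rewrite 1 [← hpt z]
      rw [mul_assoc]
      exact image_mul_subset _ _
    · exact ⟨z', by rw [mul_apply_of_some (setAt_self _ _ _), hqz]⟩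
  have hp' : p.rank ≤ m := by omega
  have h1 := map_mul_map_comm hν hp' (hr z) hq (by rwa [hpt]) hlt
  have h2 := map_mul_map_comm hν hp' (hr z') hq' (by rwa [hpt]) (heq ▸ hlt)
  rw [hpt] at h1 h2
  rw [h1, h2, heq]

/-- With a left factor of rank `k + 1`, two points remain outside its image. A common right factor
`r` uses them to keep one extra value of `q` and one of `q'`, so it is linked to both; its rank is
at most `k + 2`. -/
theorem map_mul_map_eq_of_mul_eq
    (hν : ∀ x y : PartialTransformation n, x.rank ≤ m → y.rank ≤ m → k < (x * y).rank →
      ν (x * y) = ν x * ν y)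
    (hkm : k + 2 ≤ m) (hkn : k + 3 ≤ n)
    {p q q' : PartialTransformation n} (hp : p.rank = k + 1) (hq : q.rank ≤ m) (hq' : q'.rank ≤ m)
    (hqk : k < q.rank) (hqk' : k < q'.rank) (hk : (p * q).rank = k) (h : p * q' = p * q) :
    ν p * ν q = ν p * ν q' := by
  obtain ⟨y, ⟨z, hz⟩, hy⟩ := exists_mem_notMem_of_rank_lt (hk.trans_lt hqk)
  obtain ⟨y', ⟨z', hz'⟩, hy'⟩ := exists_mem_notMem_of_rank_lt (hk.trans_lt hqk')
  obtain ⟨c, c', hc, hc', hcc⟩ := exists_ne_notMem_image (f := p) (by omega)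
  let r : PartialTransformation n := ((restrict p.image q).setAt c y).setAt c' y'
  have hrc : r c = some y := by
    simp only [r]; rw [setAt_of_ne _ hcc, setAt_self]
  have hrc' : r c' = some y' := setAt_self _ _ _
  have hrp : ∀ v ∈ p.image, r v = q v := fun v hv => by
    simp only [r]
    rw [setAt_of_ne _ (ne_of_mem_of_not_mem hv hc'), setAt_restrict_of_mem hv hc]
  have hrm : r.rank ≤ m := by
    have h1 : (restrict p.image q).rank = k := by
      rw [rank, image_restrict, ← image_mul]; exact hk
    have h2 := rank_setAt_le (restrict p.image q) c y
    have h3 := rank_setAt_le ((restrict p.image q).setAt c y) c' y'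
    simp only [r]
    omega
  have hqq' : ∀ v ∈ p.image, r v = q' v := fun v hv => by
    rw [hrp v hv]
    obtain ⟨x, hx⟩ := hv
    rw [← mul_apply_of_some hx q, ← mul_apply_of_some hx q', h]
  rw [map_mul_map_eq_of_eqOn hν (by omega) hq hrm (by omega) hk hrp hc hz hrc hy,
    map_mul_map_eq_of_eqOn hν (by omega) hq' hrm (by omega) (h ▸ hk) hqq' hc' hz' hrc'
      (by rwa [h])]

/-- Both sides are carried to a product with left factor `p`. The new right factor agrees with `t *
q` on the image of `p`, where `s` determines it, and sends one outside point `z` to a value `y`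
missed by `s`, so it is the same for both. -/
theorem map_mul_map_eq_of_left_multiple
    (hν : ∀ x y : PartialTransformation n, x.rank ≤ m → y.rank ≤ m → k < (x * y).rank →
      ν (x * y) = ν x * ν y)
    (hkm : k + 2 ≤ m) (hkn : k + 3 ≤ n)
    {s p t₁ t₂ q₁ q₂ : PartialTransformation n} (hs : s.rank = k) (hp : p.rank ≤ k + 2)
    (h₁ : (p * t₁).rank = k + 1) (h₂ : (p * t₂).rank = k + 1)
    (hq₁ : q₁.rank ≤ m) (hq₂ : q₂.rank ≤ m) (hk₁ : k < q₁.rank) (hk₂ : k < q₂.rank)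
    (hs₁ : p * t₁ * q₁ = s) (hs₂ : p * t₂ * q₂ = s) :
    ν (p * t₁) * ν q₁ = ν (p * t₂) * ν q₂ := by
  obtain ⟨z, hz⟩ := exists_notMem_image (f := p) (by omega)
  obtain ⟨y, hy⟩ := exists_notMem_image (f := s) (by omega)
  have key : ∀ t q : PartialTransformation n, (p * t).rank = k + 1 → q.rank ≤ m → k < q.rank →
      p * t * q = s →
      ν (p * t) * ν q = ν p * ν ((restrict p.image (t * q)).setAt z y) := by
    intro t q ht hq hkq hsq
    obtain ⟨c, hc⟩ := exists_notMem_image (f := p * t) (by omega)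
    -- The path `z ↦ c ↦ y` avoids the images of `p` and `p * t`; it leaves the product with `p`
    -- unchanged and lifts the rank of `t' * q'` above `k`.
    let t' := (restrict p.image t).setAt z c
    let q' := (restrict (p * t).image q).setAt c y
    have hpt : p * t' = p * t := mul_congr_right fun v hv => setAt_restrict_of_mem hv hz c
    have hptq : p * t * q' = p * t * q :=
      mul_congr_right fun v hv => setAt_restrict_of_mem hv hc y
    have ht' : t'.rank ≤ m := by
      have h1 : (restrict p.image t).rank = k + 1 := by
        rw [rank, image_restrict, ← image_mul]; exact ht
      have h2 := rank_setAt_le (restrict p.image t) z c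
      simp only [t']
      omega
    have hq'm : q'.rank ≤ m := by
      have h1 : (restrict (p * t).image q).rank = k := by
        rw [rank, image_restrict, ← image_mul, hsq]; exact hs
      have h2 := rank_setAt_le (restrict (p * t).image q) c y
      simp only [q']
      omega
    have htq : t' * q' = (restrict p.image (t * q)).setAt z y := by
      funext v
      by_cases hvz : v = z
      · subst hvz
        rw [setAt_self, mul_apply_of_some (setAt_self _ _ _)]
        exact setAt_self _ _ _
      · by_cases hv : v ∈ p.image
        · have h1 : t' v = t v := setAt_restrict_of_mem hv hz c
          rw [setAt_restrict_of_mem hv hz]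
          cases htv : t v with
          | none => rw [mul_apply_of_none (h1.trans htv), mul_apply_of_none htv]
          | some u =>
            rw [mul_apply_of_some (h1.trans htv), mul_apply_of_some htv]
            refine setAt_restrict_of_mem ?_ hc y
            rw [image_mul]
            exact ⟨v, hv, htv⟩
        · have h1 : t' v = none := setAt_restrict_of_notMem hv hvz c
          rw [mul_apply_of_none h1, setAt_restrict_of_notMem hv hvz]
    have hlt : k < (t' * q').rank := by
      rw [← hs]
      refine lt_rank_of_mem (y := y) ?_ ⟨z, by rw [htq, setAt_self]⟩ hy
      rw [← hsq, ← hptq, ← hpt, mul_assoc]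
      exact image_mul_subset _ _
    have hq'k : k < q'.rank := hlt.trans_le (rank_mul_le_right _ _)
    rw [map_mul_map_eq_of_mul_eq hν hkm hkn ht hq hq'm hkq hq'k (by rw [hsq, hs]) hptq, ← hpt,
      map_mul_map_comm hν (by omega) ht' hq'm (by rw [hpt]; omega) hlt, htq]
  rw [key t₁ q₁ h₁ hq₁ hk₁ hs₁, key t₂ q₂ h₂ hq₂ hk₂ hs₂]
  congr 3
  funext v
  by_cases hv : v ∈ p.image
  · rw [restrict_of_mem hv, restrict_of_mem hv]
    obtain ⟨x, hx⟩ := hv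
    rw [← mul_apply_of_some hx (t₁ * q₁), ← mul_apply_of_some hx (t₂ * q₂),
      ← mul_assoc, ← mul_assoc, hs₁, hs₂]
  · rw [restrict_of_notMem hv, restrict_of_notMem hv]

/-- A factorization with a right factor of rank less than `m` can be replaced by one whose left
factor has the least possible rank. -/
theorem exists_map_mul_map_eq_of_rank_lt
    (hν : ∀ x y : PartialTransformation n, x.rank ≤ m → y.rank ≤ m → k < (x * y).rank →
      ν (x * y) = ν x * ν y)
    (hmn : m ≤ n) {p q : PartialTransformation n} (hp : p.rank ≤ m) (hq : q.rank < m)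
    (hpk : k < p.rank) (hqk : k < q.rank) (hk : (p * q).rank = k) :
    ∃ p' q' : PartialTransformation n, p'.rank = k + 1 ∧ q'.rank ≤ m ∧ k < q'.rank ∧
      p' * q' = p * q ∧ ν p * ν q = ν p' * ν q' := by
  obtain ⟨b, hb, hbv⟩ := exists_redundant (p := p) (q := q) (by omega)
  obtain ⟨w, hw⟩ := exists_notMem_image (f := q) (by omega)
  have hws : w ∉ (p * q).image := fun h => hw (image_mul_subset _ _ h)
  -- Here `q = q.setAt b w * q'`, and the first factor moves to the left. Since `b` is redundant, `p
  -- * q.setAt b w` gains just the value `w`. The bound `q.rank < m` keeps `q.setAt b w` in the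
  -- ideal.
  let q' : PartialTransformation n := fun v => if v = w then q b else restrict q.image 1 v
  have hq'w : q' w = q b := if_pos rfl
  have hq'v : ∀ v ∈ q.image, q' v = some v := fun v hv =>
    (if_neg (ne_of_mem_of_not_mem hv hw)).trans (restrict_of_mem hv 1)
  have hq'im : q'.image ⊆ q.image := by
    rintro y ⟨v, hv⟩
    by_cases h : v = w
    · subst h; rw [hq'w] at hv; exact ⟨b, hv⟩
    · have : y ∈ (restrict q.image 1).image := ⟨v, by rw [← hv]; exact (if_neg h).symm⟩
      rwa [image_restrict, mapSet_one] at this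
  have htq : q.setAt b w * q' = q := by
    funext v
    by_cases h : v = b
    · subst h; rw [mul_apply_of_some (setAt_self _ _ _), hq'w]
    · have h1 := setAt_of_ne q h w
      cases hv : q v with
      | none => rw [mul_apply_of_none (h1.trans hv)]
      | some u => rw [mul_apply_of_some (h1.trans hv), hq'v u ⟨v, hv⟩]
  have him : (p * q.setAt b w).image = insert w (p * q).image := by
    ext y
    rw [image_mul, image_mul]
    constructor
    · rintro ⟨u, hu, hy⟩
      by_cases h : u = b
      · subst h; rw [setAt_self] at hy; exact Or.inl (Option.some_injective _ hy).symm
      · rw [setAt_of_ne _ h] at hy; exact Or.inr ⟨u, hu, hy⟩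
    · rintro (rfl | hy)
      · exact ⟨b, hb, setAt_self _ _ _⟩
      · obtain ⟨v, hv, hvb, h⟩ := hbv y (by rwa [image_mul])
        exact ⟨v, hv, by rwa [setAt_of_ne _ hvb]⟩
  have hrk : (p * q.setAt b w).rank = k + 1 := by
    rw [rank, him, Set.ncard_insert_of_notMem hws (Set.toFinite _), ← hk, rank]
  have ht := rank_setAt_le q b w
  have hq'le : q'.rank ≤ q.rank := rank_le_ncard hq'im
  have hle : q.rank ≤ q'.rank := by
    nth_rewrite 1 [← htq]
    exact rank_mul_le_right _ _
  refine ⟨p * q.setAt b w, q', hrk, by omega, by omega, by rw [mul_assoc, htq], ?_⟩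
  rw [map_mul_map_comm hν hp (by omega) (by omega) (by omega) (by rwa [htq]), htq]

/-- If `q` has rank `m`, then `k + n < 2 * m` forces `p` to have smaller rank. There is then room to
replace `q` off the image of `p` by a map of rank `k + 1`, which is less than `m`. -/
theorem exists_map_mul_map_eq
    (hν : ∀ x y : PartialTransformation n, x.rank ≤ m → y.rank ≤ m → k < (x * y).rank →
      ν (x * y) = ν x * ν y)
    (hmn : m ≤ n) (hkm : k + 2 ≤ m) (hknm : k + n < 2 * m)
    {p q : PartialTransformation n} (hp : p.rank ≤ m) (hq : q.rank ≤ m)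
    (hpk : k < p.rank) (hqk : k < q.rank) (hk : (p * q).rank = k) :
    ∃ p' q' : PartialTransformation n, p'.rank = k + 1 ∧ q'.rank ≤ m ∧ k < q'.rank ∧
      p' * q' = p * q ∧ ν p * ν q = ν p' * ν q' := by
  by_cases hqm : q.rank < m
  · exact exists_map_mul_map_eq_of_rank_lt hν hmn hp hqm hpk hqk hk
  have hpm : p.rank < m := by have := rank_add_rank_le p q; omega
  obtain ⟨y, ⟨z, hz⟩, hy⟩ := exists_mem_notMem_of_rank_lt (hk.trans_lt hqk)
  have hzp : z ∉ p.image := fun h => hy (by rw [image_mul]; exact ⟨z, h, hz⟩)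
  let q' : PartialTransformation n := (restrict p.image q).setAt z y
  have hqq : ∀ v ∈ p.image, q' v = q v := fun v hv => setAt_restrict_of_mem hv hzp y
  have hpq : p * q' = p * q := mul_congr_right hqq
  have hq'z : q' z = some y := setAt_self _ _ _
  have hq' : q'.rank ≤ k + 1 := by
    have h1 : (restrict p.image q).rank = k := by rw [rank, image_restrict, ← image_mul]; exact hk
    have h2 := rank_setAt_le (restrict p.image q) z y
    simp only [q']
    omega
  have hq'k : k < q'.rank := by
    rw [← hk]
    exact lt_rank_of_mem (by rw [← hpq]; exact image_mul_subset _ _) ⟨z, hq'z⟩ hy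
  obtain ⟨p₁, q₁, h1, h2, h3, h4, h5⟩ := exists_map_mul_map_eq_of_rank_lt hν hmn hp
    (by omega) hpk hq'k (by rw [hpq, hk])
  refine ⟨p₁, q₁, h1, h2, h3, h4.trans hpq, ?_⟩
  rw [← h5]
  exact map_mul_map_eq_of_eqOn hν hpm hq (by omega) hpk hk hqq hzp hz hq'z hy

/-- Each factorization is brought to the left factor `s.setAt x w` for some redundant point `x` of
`s`. Different choices of `x` are compared through a common left factor of rank at most `k + 2`. -/
theorem map_mul_map_eq
    (hν : ∀ x y : PartialTransformation n, x.rank ≤ m → y.rank ≤ m → k < (x * y).rank →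
      ν (x * y) = ν x * ν y)
    (hmn : m ≤ n) (hkm : k + 2 ≤ m) (hkn : k + 3 ≤ n) (hknm : k + n < 2 * m)
    {p q p' q' : PartialTransformation n} (hp : p.rank ≤ m) (hq : q.rank ≤ m)
    (hp' : p'.rank ≤ m) (hq' : q'.rank ≤ m)
    (hpk : k < p.rank) (hqk : k < q.rank) (hpk' : k < p'.rank) (hqk' : k < q'.rank)
    (hk : (p * q).rank = k) (heq : p' * q' = p * q) : ν p * ν q = ν p' * ν q' := by
  set s := p * q with hs
  obtain ⟨w, w', hw, hw', hww⟩ := exists_ne_notMem_image (f := s) (by omega)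
  -- every factorization is equivalent to one whose left factor moves one redundant point to `w`
  have key : ∀ p q : PartialTransformation n, p.rank ≤ m → q.rank ≤ m → k < p.rank → k < q.rank →
      p * q = s → ∃ x, (∀ y ∈ s.image, ∃ v, v ≠ x ∧ s v = some y) ∧
        ∀ r : PartialTransformation n, r.rank ≤ m → k < r.rank → s.setAt x w * r = s →
          ν p * ν q = ν (s.setAt x w) * ν r := by
    intro p q hp hq hpk hqk hpq
    obtain ⟨p₁, q₁, hp₁, hq₁, hqk₁, hpq₁, hνpq⟩ :=
      exists_map_mul_map_eq hν hmn hkm hknm hp hq hpk hqk (by rw [hpq, hk])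
    rw [hpq] at hpq₁
    obtain ⟨b, ⟨x, hx⟩, hbv⟩ := exists_redundant (p := p₁) (q := q₁) (by rw [hpq₁]; omega)
    rw [hpq₁] at hbv
    have hred : ∀ y ∈ s.image, ∃ v, v ≠ x ∧ s v = some y := by
      intro y hy
      obtain ⟨u, ⟨v, hv⟩, hub, hu⟩ := hbv y hy
      refine ⟨v, ?_, by rw [← hpq₁, mul_apply_of_some hv, hu]⟩
      rintro rfl
      exact hub (Option.some_injective _ (hv.symm.trans hx))
    refine ⟨x, hred, fun r hr hrk hsr => ?_⟩
    rw [hνpq]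
    obtain ⟨c, hc⟩ := exists_notMem_image (f := p₁) (by omega)
    -- Separating `x` from its fibre by the fresh value `c` gives a common left factor: sending `c`
    -- to `b` recovers `p₁`, while sending `c` to `w` and applying `q₁` elsewhere gives `s.setAt x
    -- w`.
    have e₁ : p₁.setAt x c * setAt 1 c b = p₁ := by
      funext v
      by_cases h : v = x
      · subst h; rw [mul_apply_of_some (setAt_self _ _ _), setAt_self, hx]
      · have h1 := setAt_of_ne p₁ h c
        cases hv : p₁ v with
        | none => rw [mul_apply_of_none (h1.trans hv)]
        | some u =>
          rw [mul_apply_of_some (h1.trans hv),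
            setAt_of_ne _ (ne_of_mem_of_not_mem (⟨v, hv⟩ : u ∈ p₁.image) hc)]
          rfl
    have e₂ : p₁.setAt x c * q₁.setAt c w = s.setAt x w := by
      funext v
      by_cases h : v = x
      · subst h; rw [mul_apply_of_some (setAt_self _ _ _), setAt_self, setAt_self]
      · have h1 := setAt_of_ne p₁ h c
        rw [setAt_of_ne s h, ← hpq₁]
        cases hv : p₁ v with
        | none => rw [mul_apply_of_none (h1.trans hv), mul_apply_of_none hv]
        | some u =>
          rw [mul_apply_of_some (h1.trans hv), mul_apply_of_some hv,
            setAt_of_ne _ (ne_of_mem_of_not_mem (⟨v, hv⟩ : u ∈ p₁.image) hc)]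
    have hrs := rank_setAt_of_redundant hw hred
    have := map_mul_map_eq_of_left_multiple (q₁ := q₁) (q₂ := r) hν hkm hkn hk
      (p := p₁.setAt x c) (t₁ := setAt 1 c b)
      (t₂ := q₁.setAt c w) ((rank_setAt_le _ _ _).trans (by omega)) (by rw [e₁, hp₁])
      (by rw [e₂]; omega) hq₁ hr hqk₁ hrk (by rw [e₁, hpq₁]) (by rw [e₂, hsr])
    rwa [e₁, e₂] at this
  obtain ⟨x, hx, hxr⟩ := key p q hp hq hpk hqk rfl
  obtain ⟨x', hx', hxr'⟩ := key p' q' hp' hq' hpk' hqk' heq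
  obtain ⟨r, hr, hsr⟩ := exists_setAt_mul_eq hw hx (by omega)
  obtain ⟨r', hr', hsr'⟩ := exists_setAt_mul_eq hw hx' (by omega)
  rw [hxr r (by omega) (by omega) hsr, hxr' r' (by omega) (by omega) hsr']
  by_cases hxx : x = x'
  · subst hxx
    rw [← hxr r (by omega) (by omega) hsr, hxr r' (by omega) (by omega) hsr']
  -- compare both with the map that moves `x` to `w` and `x'` to `w'`
  let P := (s.setAt x w).setAt x' w'
  let t₁ : PartialTransformation n := fun v => if v = w' then s x' else some v
  let t₂ : PartialTransformation n := fun v =>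
    if v = w' then some w else if v = w then s x else some v
  have hPx : P x = some w := by simp only [P]; rw [setAt_of_ne _ hxx, setAt_self]
  have hPx' : P x' = some w' := setAt_self _ _ _
  have hPv : ∀ v, v ≠ x → v ≠ x' → P v = s v := fun v h h' => by
    simp only [P]; rw [setAt_of_ne _ h', setAt_of_ne _ h]
  have e₁ : P * t₁ = s.setAt x w := by
    funext v
    by_cases h : v = x
    · subst h
      rw [mul_apply_of_some hPx, setAt_self]
      exact if_neg hww
    by_cases h' : v = x'
    · subst h'
      rw [mul_apply_of_some hPx', setAt_of_ne _ h]
      exact if_pos rfl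
    rw [setAt_of_ne _ h]
    cases hv : s v with
    | none => rw [mul_apply_of_none ((hPv v h h').trans hv)]
    | some u =>
      rw [mul_apply_of_some ((hPv v h h').trans hv)]
      exact if_neg (ne_of_mem_of_not_mem (⟨v, hv⟩ : u ∈ s.image) hw')
  have e₂ : P * t₂ = s.setAt x' w := by
    funext v
    by_cases h : v = x
    · subst h
      rw [mul_apply_of_some hPx, setAt_of_ne _ hxx]
      exact (if_neg hww).trans (if_pos rfl)
    by_cases h' : v = x'
    · subst h'
      rw [mul_apply_of_some hPx', setAt_self]
      exact if_pos rfl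
    rw [setAt_of_ne _ h']
    cases hv : s v with
    | none => rw [mul_apply_of_none ((hPv v h h').trans hv)]
    | some u =>
      have hu : u ∈ s.image := ⟨v, hv⟩
      rw [mul_apply_of_some ((hPv v h h').trans hv)]
      exact (if_neg (ne_of_mem_of_not_mem hu hw')).trans (if_neg (ne_of_mem_of_not_mem hu hw))
  have hP : P.rank ≤ k + 2 := by
    have h1 := rank_setAt_le s x w
    have h2 := rank_setAt_le (s.setAt x w) x' w'
    simp only [P]
    omega
  have hrx := rank_setAt_of_redundant hw hx
  have hrx' := rank_setAt_of_redundant hw hx'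
  have := map_mul_map_eq_of_left_multiple (q₁ := r) (q₂ := r') hν hkm hkn hk hP
    (t₁ := t₁) (t₂ := t₂) (by rw [e₁]; omega) (by rw [e₂]; omega) (by omega) (by omega)
    (by omega) (by omega) (by rw [e₁, hsr]) (by rw [e₂, hsr'])
  rwa [e₁, e₂] at this

end Connectivity

end PartialTransformation

/-! ### Presentations from evaluation maps; depth in terms of rank -/

/-- A presentation from a surjective evaluation map whose kernel is generated by the relations. -/
noncomputable def SemigroupPresentation.ofMulHom {S : Type*} [Semigroup S] {A : Type} [Finite A]
    (f : FreeSemigroup A →ₙ* S) (hf : Function.Surjective f)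
    (R : Set (FreeSemigroup A × FreeSemigroup A)) (hR : ∀ u v, (u, v) ∈ R → f u = f v)
    (hc : ∀ u v, f u = f v → conGen (fun u v => (u, v) ∈ R) u v) : SemigroupPresentation S where
  alphabet := A
  finite_alphabet := inferInstance
  relations := R
  iso := MulEquiv.ofBijective
    ({ toFun := fun q => Con.liftOn q f fun _ _ h =>
        (Con.ker_rel f).1 (Con.conGen_le (c := Con.ker f).2 (fun u v h => hR u v h) h)
       map_mul' := fun x y => Con.induction_on₂ x y fun a b => map_mul f a b } :
      (conGen fun u v => (u, v) ∈ R).Quotient →ₙ* S)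
    ⟨fun x y => Con.induction_on₂ x y fun a b h => (Con.eq _).2 (hc a b h),
      fun s => let ⟨w, hw⟩ := hf s; ⟨(w : (conGen fun u v => (u, v) ∈ R).Quotient), hw⟩⟩

namespace PartialTransformation

variable {n m : ℕ}

theorem rank_le_of_mem (x : rankIdeal n m) : x.1.rank ≤ m := x.2

/-- Embed the image of `z` in that of `x`; `a` follows `z` by a choice of preimages under `x`, and
`b` inverts the embedding. The bounds on `a` and `b` keep them inside every rank ideal containing
`z`. -/
theorem exists_mul_mul_eq {x z : PartialTransformation n} (h : z.rank ≤ x.rank) :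
    ∃ a b : PartialTransformation n, a.rank ≤ z.rank ∧ b.rank ≤ z.rank ∧ z = a * x * b := by
  rcases isEmpty_or_nonempty (Fin n) with hn | hn
  · exact ⟨z, z, le_rfl, le_rfl, funext fun v => hn.elim v⟩
  obtain ⟨f, hf, hinj⟩ : ∃ f : Fin n → Fin n, z.image ⊆ f ⁻¹' x.image ∧ z.image.InjOn f := by
    refine Set.Finite.exists_injOn_of_encard_le (Set.toFinite _) ?_
    rw [← (Set.toFinite z.image).cast_ncard_eq, ← (Set.toFinite x.image).cast_ncard_eq]
    exact_mod_cast h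
  have hσ : ∀ y ∈ z.image, ∃ u, x u = some (f y) := fun y hy => hf hy
  choose! σ hσ using hσ
  classical
  let b : PartialTransformation n := fun v =>
    if h : ∃ y ∈ z.image, f y = v then some h.choose else none
  have hb : ∀ y ∈ z.image, b (f y) = some y := by
    intro y hy
    have h : ∃ y' ∈ z.image, f y' = f y := ⟨y, hy, rfl⟩
    refine (dif_pos h).trans (congrArg some ?_)
    exact hinj h.choose_spec.1 hy h.choose_spec.2
  let g : PartialTransformation n := fun y => some (σ y)
  refine ⟨z * g, b, rank_mul_le_left _ _, rank_le_ncard ?_, ?_⟩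
  · rintro y ⟨v, hv⟩
    by_cases h : ∃ y ∈ z.image, f y = v
    · obtain rfl : h.choose = y := Option.some_injective _ ((dif_pos h).symm.trans hv)
      exact h.choose_spec.1
    · cases (dif_neg h).symm.trans hv
  · funext v
    rw [mul_assoc, mul_assoc]
    cases hv : z v with
    | none => rw [mul_apply_of_none hv]
    | some y =>
      have hy : y ∈ z.image := ⟨v, hv⟩
      rw [mul_apply_of_some hv, mul_apply_of_some (f := g) (y := σ y) rfl,
        mul_apply_of_some (hσ y hy), hb y hy]

theorem mem_principalIdeal_iff (x z : rankIdeal n m) :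
    z ∈ principalIdeal x ↔ z.1.rank ≤ x.1.rank := by
  constructor
  · rintro ⟨a, b, h⟩
    have key : ∀ (y : rankIdeal n m) (c : WithOne (rankIdeal n m)),
        (∃ w : rankIdeal n m, (w : WithOne (rankIdeal n m)) = c * (y : WithOne (rankIdeal n m)) ∧
          w.1.rank ≤ y.1.rank) ∧
        (∃ w : rankIdeal n m, (w : WithOne (rankIdeal n m)) = (y : WithOne (rankIdeal n m)) * c ∧
          w.1.rank ≤ y.1.rank) := by
      intro y c
      cases c with
      | one => exact ⟨⟨y, by simp, le_rfl⟩, ⟨y, by simp, le_rfl⟩⟩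
      | coe c =>
        exact ⟨⟨c * y, by simp, rank_mul_le_right _ _⟩, ⟨y * c, by simp, rank_mul_le_left _ _⟩⟩
    obtain ⟨w, hw, hwx⟩ := (key x a).1
    obtain ⟨w', hw', hww'⟩ := (key w b).2
    rw [← hw, ← hw', WithOne.coe_inj] at h
    rw [h]
    exact hww'.trans hwx
  · intro h
    obtain ⟨a, b, ha, hb, hz⟩ := exists_mul_mul_eq h
    have hzm := rank_le_of_mem z
    refine ⟨((⟨a, ha.trans hzm⟩ : rankIdeal n m) : WithOne _),
      ((⟨b, hb.trans hzm⟩ : rankIdeal n m) : WithOne _), ?_⟩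
    rw [← WithOne.coe_mul, ← WithOne.coe_mul, WithOne.coe_inj]
    exact Subtype.ext hz

theorem principalIdeal_subset_iff (x y : rankIdeal n m) :
    principalIdeal x ⊆ principalIdeal y ↔ x.1.rank ≤ y.1.rank := by
  constructor
  · exact fun h => (mem_principalIdeal_iff y x).1 (h ((mem_principalIdeal_iff x x).2 le_rfl))
  · intro h z hz
    rw [mem_principalIdeal_iff] at hz ⊢
    exact hz.trans h

theorem jClass_eq (x : rankIdeal n m) : jClass x = {y | y.1.rank = x.1.rank} := by
  ext y
  simp only [jClass, Set.mem_ofPred_eq]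
  rw [Set.Subset.antisymm_iff, principalIdeal_subset_iff, principalIdeal_subset_iff, le_antisymm_iff]

/-- The `J`-classes above that of `s` correspond to the ranks from `s.1.rank` to `m`, all of which
occur because `m ≤ n`. -/
theorem elementDepth_eq (hmn : m ≤ n) (s : rankIdeal n m) :
    elementDepth s = ((m - s.1.rank + 1 : ℕ) : ℕ∞) := by
  have h : {J : Set (rankIdeal n m) | ∃ t, J = jClass t ∧ principalIdeal s ⊆ principalIdeal t} =
      (fun j => {y : rankIdeal n m | y.1.rank = j}) '' (Finset.Icc s.1.rank m : Set ℕ) := by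
    ext J
    constructor
    · rintro ⟨t, rfl, ht⟩
      refine ⟨t.1.rank, ?_, (jClass_eq t).symm⟩
      rw [Finset.coe_Icc]
      exact ⟨(principalIdeal_subset_iff s t).1 ht, rank_le_of_mem t⟩
    · rintro ⟨j, hj, rfl⟩
      rw [Finset.coe_Icc] at hj
      obtain ⟨f, hf⟩ := exists_rank_eq (hj.2.trans hmn)
      refine ⟨⟨f, hf.trans_le hj.2⟩, ?_, ?_⟩
      · rw [jClass_eq, hf]
      · rw [principalIdeal_subset_iff, hf]; exact hj.1
  rw [elementDepth, h, Set.InjOn.encard_image, Set.encard_coe_eq_coe_finsetCard, Nat.card_Icc]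
  · have := rank_le_of_mem s
    congr 1
    omega
  · intro i hi j hj hij
    rw [Finset.coe_Icc] at hi
    obtain ⟨f, hf⟩ := exists_rank_eq (hi.2.trans hmn)
    have : (⟨f, hf.trans_le hi.2⟩ : rankIdeal n m) ∈ {y : rankIdeal n m | y.1.rank = j} := by
      exact hij.subset (show f.rank = i from hf)
    exact hf.symm.trans this

instance : Finite (PartialTransformation n) := inferInstanceAs (Finite (Fin n → Option (Fin n)))

/-! ### The upper bound: a presentation by elements of high rank -/

section Upper

variable (n m) in
/-- The elements of `rankIdeal n m` of rank at least `r`, as an alphabet. -/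
abbrev HighRank (r : ℕ) : Type := {x : rankIdeal n m // r ≤ x.1.rank}

variable (n m) in
/-- The evaluation of words over the alphabet of elements of rank at least `r`. -/
def highRankEval (r : ℕ) : FreeSemigroup (HighRank n m r) →ₙ* rankIdeal n m :=
  FreeSemigroup.lift Subtype.val

variable (n m) in
/-- All the relations of rank at least `r` that hold between words of elements of rank at
least `r`. -/
def highRankRelations (r : ℕ) :
    Set (FreeSemigroup (HighRank n m r) × FreeSemigroup (HighRank n m r)) :=
  {p | highRankEval n m r p.1 = highRankEval n m r p.2 ∧ r ≤ (highRankEval n m r p.1).1.rank}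

variable {r : ℕ}

theorem highRankEval_surjective (hr : ∀ k < r, k + 2 ≤ m ∧ k + 3 ≤ n ∧ k + n < 2 * m) :
    Function.Surjective (highRankEval n m r) := by
  suffices h : ∀ j, ∀ s : rankIdeal n m, r ≤ s.1.rank + j → ∃ w, highRankEval n m r w = s from
    fun s => h r s (by omega)
  intro j
  induction j with
  | zero => exact fun s hs => ⟨FreeSemigroup.of ⟨s, hs⟩, rfl⟩
  | succ j ih =>
    intro s hs
    by_cases hsr : r ≤ s.1.rank
    · exact ⟨FreeSemigroup.of ⟨s, hsr⟩, rfl⟩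
    obtain ⟨h1, h2, -⟩ := hr s.1.rank (by omega)
    have hone : (1 : PartialTransformation n).rank = n := by
      rw [rank, ← mapSet_univ, mapSet_one, Set.ncard_univ, Nat.card_eq_fintype_card,
        Fintype.card_fin]
    obtain ⟨p, q, hp, hq, hpq, -⟩ := exists_factorization (x := 1) (s := s.1) (by rw [one_mul])
      (by omega) (by omega)
    obtain ⟨u, hu⟩ := ih ⟨p, show p.rank ≤ m by omega⟩ (by simp only; omega)
    obtain ⟨v, hv⟩ := ih ⟨q, show q.rank ≤ m by omega⟩ (by simp only; omega)
    exact ⟨u * v, by rw [map_mul, hu, hv]; exact Subtype.ext hpq⟩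

/-- Induction on how far the rank lies below `r`. Above rank `k` the congruence already identifies
words of equal value, so choosing a word for each element gives a map `ν` to which the linking of
factorizations applies. -/
theorem highRank_conGen (hmn : m ≤ n)
    (hr : ∀ k < r, k + 2 ≤ m ∧ k + 3 ≤ n ∧ k + n < 2 * m)
    (u v : FreeSemigroup (HighRank n m r)) (huv : highRankEval n m r u = highRankEval n m r v) :
    conGen (fun u v => (u, v) ∈ highRankRelations n m r) u v := by
  set c := conGen (fun u v => (u, v) ∈ highRankRelations n m r) with hc
  suffices h : ∀ j u v, highRankEval n m r u = highRankEval n m r v →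
      r ≤ (highRankEval n m r u).1.rank + j → c u v from h r u v huv (by omega)
  intro j
  induction j with
  | zero => exact fun u v h hu => ConGen.Rel.of u v ⟨h, hu⟩
  | succ j ih =>
    intro u v huv hu
    by_cases hk : r ≤ (highRankEval n m r u).1.rank + j
    · exact ih u v huv hk
    set k := (highRankEval n m r u).1.rank with hkdef
    obtain ⟨hk1, hk2, hk3⟩ := hr k (by omega)
    obtain ⟨N, hN⟩ := (highRankEval_surjective hr).hasRightInverse
    classical
    -- The value at maps of rank above `m` is arbitrary, since multiplicativity is required only
    -- inside the ideal.
    let ν : PartialTransformation n → c.Quotient := fun x =>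
      if h : x.rank ≤ m then ((N ⟨x, h⟩ : FreeSemigroup (HighRank n m r)) : c.Quotient)
      else (u : c.Quotient)
    have hνN : ∀ x : rankIdeal n m, ν x.1 = (N x : c.Quotient) := fun x => dif_pos x.2
    have hνw : ∀ w, k < (highRankEval n m r w).1.rank →
        (w : c.Quotient) = ν (highRankEval n m r w).1 := by
      intro w hw
      rw [hνN, Con.eq]
      exact ih _ _ (hN _).symm (by omega)
    have hν : ∀ x y : PartialTransformation n, x.rank ≤ m → y.rank ≤ m → k < (x * y).rank →
        ν (x * y) = ν x * ν y := by
      intro x y hx hy hxy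
      have h1 : highRankEval n m r (N ⟨x, hx⟩ * N ⟨y, hy⟩) = ⟨x, hx⟩ * ⟨y, hy⟩ := by
        rw [map_mul, hN, hN]
      have h2 := hνw (N ⟨x, hx⟩ * N ⟨y, hy⟩) (by rw [h1]; exact hxy)
      rw [h1, Con.coe_mul, ← hνN, ← hνN] at h2
      exact h2.symm
    -- every word of rank `k` is equivalent to a product of two elements of larger rank
    have key : ∀ w, (highRankEval n m r w).1.rank = k → ∃ p q : PartialTransformation n,
        p.rank ≤ m ∧ q.rank ≤ m ∧ k < p.rank ∧ k < q.rank ∧ p * q = (highRankEval n m r w).1 ∧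
        (w : c.Quotient) = ν p * ν q := by
      intro w
      induction w using FreeSemigroup.recOnMul with
      | ih1 x =>
        intro h
        have : r ≤ (highRankEval n m r (FreeSemigroup.of x)).1.rank := x.2
        omega
      | ih2 x w _ ihw =>
        intro h
        have hx : highRankEval n m r (FreeSemigroup.of x) = x.1 := rfl
        have hxr : k < x.1.1.rank := lt_of_lt_of_le (by omega) x.2
        have hxν := hνw (FreeSemigroup.of x) (by rwa [hx])
        rw [hx] at hxν
        rw [map_mul, hx] at h ⊢
        have hle : k ≤ (highRankEval n m r w).1.rank := h ▸ rank_mul_le_right _ _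
        rcases hle.lt_or_eq with hlt | heq
        · exact ⟨x.1.1, (highRankEval n m r w).1, x.1.2, (highRankEval n m r w).2, hxr, hlt, rfl,
            by rw [Con.coe_mul, hxν, ← hνw w hlt]⟩
        -- When the tail already has rank `k`, its factorization is exchanged for one whose left
        -- factor keeps rank above `k` after `x`, so that `x` can be absorbed.
        · obtain ⟨p, q, hp, hq, hpk, hqk, hpq, hw⟩ := ihw heq.symm
          obtain ⟨p', q', hp', hq', hpq', hxp⟩ := exists_factorization (x := x.1.1)
            (s := (highRankEval n m r w).1) (h.trans heq) (by omega) (by omega)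
          have h1 := map_mul_map_eq (p := p) (q := q) (p' := p') (q' := q') hν hmn hk1 hk2 hk3
            hp hq (by omega) (by omega) hpk hqk (by omega) (by omega) (by rw [hpq, heq])
            (by rw [hpq', hpq])
          refine ⟨x.1.1 * p', q', (rank_mul_le_left _ _).trans x.1.2, by omega, by omega, by omega,
            by rw [mul_assoc, hpq']; rfl, ?_⟩
          rw [Con.coe_mul, hw, h1, hxν, hν _ _ x.1.2 (by omega) (by omega), mul_assoc]
    obtain ⟨p, q, hp, hq, hpk, hqk, hpq, hw⟩ := key u rfl
    obtain ⟨p', q', hp', hq', hpk', hqk', hpq', hw'⟩ := key v (by rw [← huv])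
    rw [← Con.eq, hw, hw']
    exact map_mul_map_eq hν hmn hk1 hk2 hk3 hp hq hp' hq' hpk hqk hpk' hqk' (by rw [hpq])
      (by rw [hpq, hpq', huv])

theorem relationalDepth_rankIdeal_le (hmn : m ≤ n)
    (hr : ∀ k < r, k + 2 ≤ m ∧ k + 3 ≤ n ∧ k + n < 2 * m) :
    relationalDepth (rankIdeal n m) ≤ ((m - r + 1 : ℕ) : ℕ∞) := by
  refine iInf_le_of_le (SemigroupPresentation.ofMulHom (highRankEval n m r)
    (highRankEval_surjective hr) (highRankRelations n m r) (fun u v h => h.1)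
    (highRank_conGen hmn hr)) ?_
  refine iSup₂_le fun p hp => ?_
  change elementDepth (highRankEval n m r p.1) ≤ _
  rw [elementDepth_eq hmn]
  have h : r ≤ (highRankEval n m r p.1).1.rank := hp.2
  exact_mod_cast Nat.succ_le_succ (Nat.sub_le_sub_left h m)

end Upper

end PartialTransformation

/-! ### The lower bound: an automaton that detects the junction -/

namespace PartialTransformation

variable {n m : ℕ}

/-- The states of an automaton reading words in partial transformations: it stores the product next
so far while its rank is large, and the domain of the left factor and the image of the right factor
once the rank has dropped at the junction of two factors. -/
inductive ReadingState (n : ℕ) : Type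
  | product (s : PartialTransformation n)
  | junction (D Y : Set (Fin n))
  | dead

namespace ReadingState

open scoped Classical in
/-- Reading the partial transformation `x`. -/
noncomputable def next (r μ : ℕ) : ReadingState n → PartialTransformation n → ReadingState n
  | product s, x =>
    if r < (s * x).rank then product (s * x)
    else if s.rank = μ ∧ x.rank = μ then junction s.dom x.image else dead
  | junction D Y, x => if (mapSet Y x).ncard = Y.ncard then junction D (mapSet Y x) else dead
  | dead, _ => dead

end ReadingState

theorem rank_mul_of_rank_eq {x : PartialTransformation n} (hx : x.rank = n)
    (s : PartialTransformation n) : (s * x).rank = s.rank := by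
  rw [rank, image_mul, rank]
  refine ncard_mapSet_eq_of_subset (Set.subset_univ _) ?_
  rw [mapSet_univ, Set.ncard_univ, Nat.card_eq_fintype_card, Fintype.card_fin]
  exact hx

theorem dom_mul_of_rank_eq {x : PartialTransformation n} (hx : x.rank = n)
    (s : PartialTransformation n) : (s * x).dom = s.dom := by
  have htot : ∀ v, x v ≠ none := by
    intro v hv
    have h := ncard_mapSet_eq_of_subset (X := Set.univ) (Y := {v}) (f := x) (Set.subset_univ _)
      (by rw [mapSet_univ, Set.ncard_univ, Nat.card_eq_fintype_card, Fintype.card_fin]; exact hx)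
    have h0 : mapSet {v} x = ∅ := by
      ext u
      simp [mapSet, hv]
    rw [h0, Set.ncard_empty, Set.ncard_singleton] at h
    cases h
  ext u
  simp only [dom, Set.mem_ofPred_eq]
  cases hu : s u with
  | none => simp [mul_apply_of_none hu]
  | some v => simp [mul_apply_of_some hu, htot v]

theorem image_mul_of_rank_eq {x : PartialTransformation n} (hx : x.rank = n)
    (y : PartialTransformation n) : (x * y).image = y.image := by
  rw [image_mul, image_eq_univ hx, mapSet_univ]

theorem rank_mul_mul_of_rank_le {s x : PartialTransformation n} (h : x.rank ≤ (s * x).rank)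
    (y : PartialTransformation n) : (s * x * y).rank = (x * y).rank := by
  rw [rank, image_mul, image_mul_eq h, ← image_mul, rank]

theorem rank_mul_mul_of_rank_eq {x y : PartialTransformation n} (h : (x * y).rank = x.rank)
    (s : PartialTransformation n) : (s * x * y).rank = (s * x).rank := by
  rw [rank, image_mul, rank]
  exact ncard_mapSet_eq_of_subset (image_mul_subset s x) (by rw [← image_mul]; exact h)

namespace ReadingState

/-- A cut inside a factor of rank above `r` cannot be noticed. A junction needs rank exactly `μ` on
both sides, and the only larger rank allowed for `x` is that of a permutation, which preserves
ranks, the domain of the left factor and the image of the right one. -/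
theorem next_mul {r μ : ℕ} (hrμ : r < μ) {x y : PartialTransformation n}
    (hx : x.rank ≤ μ ∨ x.rank = n) (hxy : r < (x * y).rank) (a : ReadingState n) :
    next r μ a (x * y) = next r μ (next r μ a x) y := by
  have hlx := rank_mul_le_left x y
  have hly := rank_mul_le_right x y
  cases a with
  | dead => rfl
  | junction D Y =>
    have h1 := ncard_mapSet_le Y x
    have h2 := ncard_mapSet_le (mapSet Y x) y
    simp only [next, mapSet_mul]
    by_cases h : (mapSet Y x).ncard = Y.ncard
    · rw [if_pos h]
      simp only [h]
    · rw [if_neg h, if_neg (by omega)]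
  | product s =>
    have hsl := rank_mul_le_left (s * x) y
    have hsx := rank_mul_le_left s x
    have hsx' := rank_mul_le_right s x
    simp only [next, ← mul_assoc]
    by_cases h1 : r < (s * x).rank
    · rw [if_pos h1]
      dsimp only
      by_cases h2 : r < (s * x * y).rank
      · rw [if_pos h2, if_pos h2]
      rw [if_neg h2, if_neg h2]
      by_cases hxn : x.rank = n
      · rw [rank_mul_of_rank_eq hxn, dom_mul_of_rank_eq hxn, image_mul_of_rank_eq hxn, rank, rank,
          rank, image_mul_of_rank_eq hxn]
      -- Neither reading forms a junction here: if `s * x` has rank `μ`, it has the whole image of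
      -- `x`, and if `x * y` has rank `μ`, then `y` is injective on the image of `x`. Either way `s
      -- * x * y` would keep rank above `r`.
      have hxμ : x.rank ≤ μ := hx.resolve_right hxn
      rw [if_neg, if_neg]
      · rintro ⟨h3, h4⟩
        rw [rank_mul_mul_of_rank_le (by omega)] at h2
        omega
      · rintro ⟨h3, h4⟩
        rw [rank_mul_mul_of_rank_eq (by omega)] at h2
        omega
    · rw [if_neg h1, if_neg (by omega)]
      by_cases h2 : s.rank = μ ∧ x.rank = μ
      · rw [if_pos h2]
        simp only [← image_mul]
        by_cases h3 : (x * y).rank = μ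
        · rw [if_pos ⟨h2.1, h3⟩, 
            if_pos (show (x * y).image.ncard = x.image.ncard from h3.trans h2.2.symm)]
        · rw [if_neg (fun h => h3 h.2), 
            if_neg (fun h : (x * y).image.ncard = x.image.ncard => h3 (h.trans h2.2))]
      · rw [if_neg h2, if_neg]
        rintro ⟨h3, h4⟩
        by_cases hxn : x.rank = n
        · rw [rank_mul_of_rank_eq hxn] at h1
          omega
        · have := hx.resolve_right hxn
          exact h2 ⟨h3, by omega⟩

/-- The transition map of `x`, in the monoid in which words act from left to right. -/
noncomputable def nextEnd (r μ : ℕ) (x : PartialTransformation n) :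
    (Function.End (ReadingState n))ᵐᵒᵖ :=
  MulOpposite.op fun q => next r μ q x

theorem nextEnd_mul {r μ : ℕ} (hrμ : r < μ) {x y : PartialTransformation n}
    (hx : x.rank ≤ μ ∨ x.rank = n) (hxy : r < (x * y).rank) :
    nextEnd r μ (x * y) = nextEnd r μ x * nextEnd r μ y :=
  congrArg MulOpposite.op (funext fun q => next_mul hrμ hx hxy q)

theorem next_next_eq_of_nextEnd_mul_eq {r μ : ℕ} {x y z w : PartialTransformation n}
    (h : nextEnd r μ x * nextEnd r μ y = nextEnd r μ z * nextEnd r μ w) (q : ReadingState n) :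
    next r μ (next r μ q x) y = next r μ (next r μ q z) w :=
  congrFun (MulOpposite.op_injective h) q

end ReadingState

theorem restrict_one_mul_restrict_one (A B : Set (Fin n)) :
    restrict A 1 * restrict B 1 = restrict (A ∩ B) (1 : PartialTransformation n) := by
  funext v
  by_cases hA : v ∈ A
  · rw [mul_apply_of_some (y := v) (restrict_of_mem hA 1)]
    by_cases hB : v ∈ B
    · rw [restrict_of_mem hB, restrict_of_mem (⟨hA, hB⟩ : v ∈ A ∩ B)]
    · rw [restrict_of_notMem hB, restrict_of_notMem (fun h : v ∈ A ∩ B => hB h.2)]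
  · rw [mul_apply_of_none (restrict_of_notMem hA 1),
      restrict_of_notMem (fun h : v ∈ A ∩ B => hA h.1)]

theorem dom_restrict_one (A : Set (Fin n)) : (restrict A 1).dom = A := by
  ext v
  by_cases hA : v ∈ A
  · simp only [dom, Set.mem_ofPred_eq, restrict_of_mem hA, hA, iff_true]
    exact Option.some_ne_none v
  · simp [dom, restrict_of_notMem hA, hA]

theorem image_restrict_one (A : Set (Fin n)) : (restrict A 1).image = A := by
  rw [image_restrict, mapSet_one]

end PartialTransformation

namespace SemigroupPresentation

variable {S : Type*} [Semigroup S] (P : SemigroupPresentation S)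

theorem eval_mul (u v : FreeSemigroup P.alphabet) : P.eval (u * v) = P.eval u * P.eval v := by
  rw [eval, Con.coe_mul, map_mul]; rfl

theorem eval_surjective : Function.Surjective P.eval := fun s => by
  obtain ⟨q, hq⟩ := P.iso.surjective s
  induction q using Con.induction_on with
  | H w => exact ⟨w, hq⟩

/-- The source of invariants: a homomorphism that respects the relations factors through the
presented semigroup. -/
theorem map_eq_of_eval_eq {M : Type*} [Mul M] (f : FreeSemigroup P.alphabet →ₙ* M)
    (hf : ∀ u v, (u, v) ∈ P.relations → f u = f v) {u v : FreeSemigroup P.alphabet}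
    (h : P.eval u = P.eval v) : f u = f v := by
  have h1 := (Con.eq _).1 (P.iso.injective h)
  exact (Con.ker_rel f).1 (Con.conGen_le (c := Con.ker f).2 (fun u v h => hf u v h) h1)

theorem eval_eq_of_mem {u v : FreeSemigroup P.alphabet} (h : (u, v) ∈ P.relations) :
    P.eval u = P.eval v :=
  congrArg P.iso ((Con.eq _).2 (ConGen.Rel.of u v h))

theorem elementDepth_le_depth {p : FreeSemigroup P.alphabet × FreeSemigroup P.alphabet}
    (hp : p ∈ P.relations) : elementDepth (P.eval p.1) ≤ P.depth :=
  le_iSup₂ (f := fun p (_ : p ∈ P.relations) => elementDepth (P.eval p.1)) p hp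

end SemigroupPresentation

namespace PartialTransformation

variable {n m : ℕ}

open ReadingState in
-- In a shallower presentation all relations have rank above `r`, so the automaton acts through the
-- semigroup. Yet reading the commuting partial identities of `A` and `B` in the two orders ends at
-- junctions with left domains `A` and `B`.
theorem le_relationalDepth_rankIdeal_of_sets {r μ : ℕ} (hmn : m ≤ n) (hrμ : r < μ) (hμm : μ ≤ m)
    (hμ : ∀ x : PartialTransformation n, x.rank ≤ m → x.rank ≤ μ ∨ x.rank = n)
    {A B : Set (Fin n)} (hA : A.ncard = μ) (hB : B.ncard = μ) (hAB : A ≠ B)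
    (hr : (A ∩ B).ncard ≤ r) :
    ((m - r + 1 : ℕ) : ℕ∞) ≤ relationalDepth (rankIdeal n m) := by
  refine le_iInf fun P => ?_
  by_contra! hlt
  have hrel : ∀ u v, (u, v) ∈ P.relations → r < (P.eval u).1.rank := by
    intro u v huv
    have h1 := (P.elementDepth_le_depth huv).trans_lt hlt
    rw [elementDepth_eq hmn] at h1
    have h2 : m - (P.eval u).1.rank + 1 < m - r + 1 := by exact_mod_cast h1
    omega
  let f : FreeSemigroup P.alphabet →ₙ* (Function.End (ReadingState n))ᵐᵒᵖ :=
    FreeSemigroup.lift fun a => nextEnd r μ (P.eval (FreeSemigroup.of a)).1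
  have hf : ∀ w, r < (P.eval w).1.rank → f w = nextEnd r μ (P.eval w).1 := by
    intro w
    induction w using FreeSemigroup.recOnMul with
    | ih1 x => exact fun _ => rfl
    | ih2 x w h1 h2 =>
      intro h
      rw [P.eval_mul] at h ⊢
      have hx : r < (P.eval (FreeSemigroup.of x)).1.rank := h.trans_le (rank_mul_le_left _ _)
      have hw : r < (P.eval w).1.rank := h.trans_le (rank_mul_le_right _ _)
      rw [map_mul, h1 hx, h2 hw]
      exact (nextEnd_mul hrμ (hμ _ (P.eval (FreeSemigroup.of x)).2) h).symm
  have hresp : ∀ u v, (u, v) ∈ P.relations → f u = f v := by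
    intro u v huv
    have h1 := hrel u v huv
    have h2 := P.eval_eq_of_mem huv
    rw [hf u h1, hf v (by rwa [← h2]), h2]
  have hAm : (restrict A (1 : PartialTransformation n)).rank = μ := by rw [rank_restrict_one, hA]
  have hBm : (restrict B (1 : PartialTransformation n)).rank = μ := by rw [rank_restrict_one, hB]
  obtain ⟨a, ha⟩ := P.eval_surjective ⟨restrict A 1, hAm.trans_le hμm⟩
  obtain ⟨b, hb⟩ := P.eval_surjective ⟨restrict B 1, hBm.trans_le hμm⟩
  have hab : P.eval (a * b) = P.eval (b * a) := by
    rw [P.eval_mul, P.eval_mul, ha, hb]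
    refine Subtype.ext ?_
    change restrict A 1 * restrict B 1 = restrict B 1 * restrict A (1 : PartialTransformation n)
    rw [restrict_one_mul_restrict_one, restrict_one_mul_restrict_one, Set.inter_comm]
  have hnext : ∀ A B : Set (Fin n), A.ncard = μ → B.ncard = μ → (A ∩ B).ncard ≤ r →
      ReadingState.next r μ (ReadingState.next r μ (product 1) (restrict A 1)) (restrict B 1) =
        junction A B := by
    intro A B hA hB hr
    simp only [ReadingState.next, one_mul]
    rw [if_pos (by rw [rank_restrict_one]; omega)]
    dsimp only
    rw [restrict_one_mul_restrict_one, if_neg (by rw [rank_restrict_one]; omega),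
      if_pos (by rw [rank_restrict_one, rank_restrict_one]; exact ⟨hA, hB⟩), dom_restrict_one,
      image_restrict_one]
  have hfab := P.map_eq_of_eval_eq f hresp hab
  have hfa : f a = nextEnd r μ (restrict A 1) := by
    rw [hf a (by rw [ha]; exact hrμ.trans_eq hAm.symm), ha]
  have hfb : f b = nextEnd r μ (restrict B 1) := by
    rw [hf b (by rw [hb]; exact hrμ.trans_eq hBm.symm), hb]
  rw [map_mul, map_mul, hfa, hfb] at hfab
  have h' := next_next_eq_of_nextEnd_mul_eq hfab (product 1)
  rw [hnext A B hA hB hr, hnext B A hB hA (by rwa [Set.inter_comm])] at h'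
  exact hAB (junction.inj h').1

/-- The initial and final segments of length `μ` overlap as little as possible; truncated
subtraction covers the case where they are disjoint. -/
theorem le_relationalDepth_rankIdeal {μ : ℕ} (hmn : m ≤ n) (hμ0 : 0 < μ) (hμn : μ < n)
    (hμm : μ ≤ m) (hμ : ∀ x : PartialTransformation n, x.rank ≤ m → x.rank ≤ μ ∨ x.rank = n) :
    ((m - (2 * μ - n) + 1 : ℕ) : ℕ∞) ≤ relationalDepth (rankIdeal n m) := by
  have hcard : ∀ i j : ℕ, j ≤ n → {x : Fin n | i ≤ x.1 ∧ x.1 < j}.ncard = j - i := by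
    intro i j hj
    have h : Fin.val '' {x : Fin n | i ≤ x.1 ∧ x.1 < j} = (Finset.Ico i j : Set ℕ) := by
      ext v
      simp only [Set.mem_image, Set.mem_ofPred_eq, Finset.coe_Ico, Set.mem_Ico]
      constructor
      · rintro ⟨x, hx, rfl⟩
        exact hx
      · exact fun hv => ⟨⟨v, by omega⟩, hv, rfl⟩
    rw [← Set.ncard_image_of_injective _ Fin.val_injective, h, Set.ncard_coe_finset, Nat.card_Ico]
  refine le_relationalDepth_rankIdeal_of_sets (A := {x | 0 ≤ x.1 ∧ x.1 < μ})
    (B := {x | n - μ ≤ x.1 ∧ x.1 < n}) hmn (by omega) hμm hμ (hcard _ _ hμn.le)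
    ((hcard _ _ le_rfl).trans (by omega)) ?_ ?_
  · intro h
    have h0 : (⟨0, by omega⟩ : Fin n) ∈ {x : Fin n | 0 ≤ x.1 ∧ x.1 < μ} := ⟨le_rfl, hμ0⟩
    rw [h] at h0
    have h1 : n - μ ≤ 0 := h0.1
    omega
  · have h : {x : Fin n | 0 ≤ x.1 ∧ x.1 < μ} ∩ {x : Fin n | n - μ ≤ x.1 ∧ x.1 < n} =
        {x : Fin n | n - μ ≤ x.1 ∧ x.1 < μ} := by
      ext x
      simp only [Set.mem_inter_iff, Set.mem_ofPred_eq]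
      omega
    rw [h, hcard _ _ hμn.le]
    omega

/-- Some relation is needed: the empty map is idempotent, whereas without relations word length
would be an invariant. This settles `m = 0`, where the automaton has no positive `μ`. -/
theorem one_le_relationalDepth_rankIdeal (hmn : m ≤ n) :
    1 ≤ relationalDepth (rankIdeal n m) := by
  refine le_iInf fun P => ?_
  by_cases hP : P.relations.Nonempty
  · obtain ⟨p, hp⟩ := hP
    refine le_trans ?_ (P.elementDepth_le_depth hp)
    rw [elementDepth_eq hmn]
    exact_mod_cast Nat.le_add_left 1 _
  · let f : FreeSemigroup P.alphabet →ₙ* Multiplicative ℕ :=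
      ⟨fun w => Multiplicative.ofAdd w.length, fun u v => by
        rw [FreeSemigroup.length_mul, ofAdd_add]⟩
    let z : PartialTransformation n := fun _ => none
    have hz : z.rank ≤ m := by
      have : z.image ⊆ ∅ := fun y ⟨x, hx⟩ => by cases hx
      exact (rank_le_ncard this).trans (by rw [Set.ncard_empty]; exact Nat.zero_le _)
    obtain ⟨w, hw⟩ := P.eval_surjective ⟨z, hz⟩
    have h : P.eval (w * w) = P.eval w := by
      rw [P.eval_mul, hw]
      exact Subtype.ext rfl
    have hlen := P.map_eq_of_eval_eq f (fun u v h => (hP ⟨_, h⟩).elim) h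
    have h1 : (w * w).length = w.length := hlen
    rw [FreeSemigroup.length_mul, FreeSemigroup.length] at h1
    omega

end PartialTransformation

theorem mainTheorem5 (n m : ℕ) (hmn : m ≤ n) :
    (m = n → 2 ≤ n → relationalDepth (PartialTransformation.rankIdeal n m) = 3) ∧
    (m < n → n < 2 * m →
      relationalDepth (PartialTransformation.rankIdeal n m) = ((n - m + 1 : ℕ) : ℕ∞)) ∧
    (m < n → 2 * m ≤ n →
      relationalDepth (PartialTransformation.rankIdeal n m) = ((m + 1 : ℕ) : ℕ∞)) := by
  refine ⟨?_, ?_, ?_⟩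
  · rintro rfl hn
    have h1 := PartialTransformation.relationalDepth_rankIdeal_le (r := m - 2) hmn
      (fun k hk => by omega)
    -- In the full monoid the permutations cannot form a junction, so `μ` is the next rank down.
    have h2 := PartialTransformation.le_relationalDepth_rankIdeal (μ := m - 1) hmn (by omega)
      (by omega) (by omega) (fun x hx => by omega)
    rw [show m - (m - 2) + 1 = 3 by omega] at h1
    rw [show m - (2 * (m - 1) - m) + 1 = 3 by omega] at h2
    exact le_antisymm h1 h2
  · intro hlt hm
    have h1 := PartialTransformation.relationalDepth_rankIdeal_le (r := 2 * m - n) hmn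
      (fun k hk => by omega)
    have h2 := PartialTransformation.le_relationalDepth_rankIdeal (μ := m) hmn (by omega)
      hlt le_rfl (fun x hx => Or.inl hx)
    rw [show m - (2 * m - n) + 1 = n - m + 1 by omega] at h1 h2
    exact le_antisymm h1 h2
  · intro hlt hm
    -- With `r = 0` every element is a generator and every true relation is allowed, so the linking
    -- conditions are vacuous.
    refine le_antisymm
      (PartialTransformation.relationalDepth_rankIdeal_le (r := 0) hmn (fun k hk => by omega)) ?_
    rcases Nat.eq_zero_or_pos m with rfl | hm0
    · exact_mod_cast PartialTransformation.one_le_relationalDepth_rankIdeal hmn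
    · have h2 := PartialTransformation.le_relationalDepth_rankIdeal (μ := m) hmn hm0 hlt le_rfl
        (fun x hx => Or.inl hx)
      rwa [show m - (2 * m - n) + 1 = m + 1 by omega] at h2
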